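/- Let $X$ be a compact metric space, $\varphi:[0,\infty)\times X\to X$ a continuous semiflow, $D\subset X$ a compact set and $I:D\to X$ a continuous map. For $x\in X$ let $\tau_1(x)=\inf\{t>0:\varphi_t(x)\in D\}\in[0,\infty]$ (with $\inf\emptyset=\infty$), and assume that $\tau_1(x)>0$ for all $x$. Put $\tau_0(x)=0$, $\gamma_x(0)=x$ and, inductively, as long as $\tau_n(x)<\infty$: $\tau_{n+1}(x)=\tau_n(x)+\tau_1(\gamma_x(\tau_n(x)))$; $\gamma_x(t)=\varphi_{t-\tau_n(x)}(\gamma_x(\tau_n(x)))$ for $\tau_n(x)\le t<\tau_{n+1}(x)$; and $\gamma_x(\tau_{n+1}(x))=I\big(\varphi_{\tau_{n+1}(x)-\tau_n(x)}(\gamma_x(\tau_n(x)))\big)$ if $\tau_{n+1}(x)<\infty$. Assume that $\sup_n\tau_n(x)=\infty$ for all $x\in X$, and let $\phi_t(x)=\gamma_x(t)$ be the resulting impulsive semiflow. Let $\Omega_\phi$ be its non-wandering set, i.e. the set of all $x\in X$ such that for every neighbourhood $U$ of $x$ and every $T>0$ there is $t\ge T$ with $\phi_t^{-1}(U)\cap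 U\ne\emptyset$. Assume that the function $\tau_D:\Omega_\phi\to[0,\infty]$, equal to $\tau_1$ on $\Omega_\phi\setminus D$ and to $0$ on $\Omega_\phi\cap D$, is continuous, and that $I(\Omega_\phi\cap D)\subset\Omega_\phi\setminus D$. Then there are a compact metric space $Y$, a continuous semiflow $\psi:[0,\infty)\times Y\to Y$ and a continuous bijection $h:\Omega_\phi\setminus D\to Y$ such that $h$ and $h^{-1}$ are Borel measurable, $\phi_t(\Omega_\phi\setminus D)\subset\Omega_\phi\setminus D$ for all $t\ge0$, and $$\psi_t\circ h=h\circ\phi_t|_{\Omega_\phi\setminus D}\qquad\text{for all }t\ge0.$$ One can take for $Y$ the topological quotient of $\Omega_\phi$ by the relation $x\sim y$ if and only if $x=y$, $y=I(x)$, $x=I(y)$ or $I(x)=I(y)$ (each condition being considered only where the values of $I$ involved are defined), which is an equivalence relation on $\Omega_\phi$, and for $h$ the restriction to $\Omega_\phi\setminus D$ of the quotient map $\pi:\Omega_\phi\to Y$. Moreover, if $\iota:\Omega_\phi\setminus D\to X$ is the inclusion, then $\nu\mapsto(\iota\circ h^{-1})_*\nu$ is a bijection from the set of $\psi$-invariant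 Borel probability measures on $Y$ onto the set of $\phi$-invariant Borel probability measures on $X$. (A Borel probability measure $\mu$ is invariant under a semiflow $\phi$ if $\phi$ is measurable as a map of $(t,x)$ and $\mu(\phi_t^{-1}(A))=\mu(A)$ for every Borel set $A$ and every $t\ge0$.) -/

import Mathlib

open Set Filter Topology MeasureTheory
open scoped NNReal ENNReal

universe u

noncomputable section

namespace Impulsive

/-- The non-wandering set of a semiflow `f : ℝ≥0 → X → X` (no continuity is required). -/
def nonWanderingSet {X : Type u} [TopologicalSpace X] (f : ℝ≥0 → X → X) : Set X :=
  {x | ∀ U ∈ 𝓝 x, ∀ T : ℝ≥0, 0 < T → ∃ t : ℝ≥0, T ≤ t ∧ (f t ⁻¹' U ∩ U).Nonempty}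

/-- The Borel probability measures that are invariant under `f : ℝ≥0 → X → X`; as part of the
notion, `f` has to be measurable as a map on `ℝ≥0 × X`. -/
def invariantMeasures {X : Type u} [MeasurableSpace X] (f : ℝ≥0 → X → X) : Set (Measure X) :=
  {μ | IsProbabilityMeasure μ ∧ Measurable (fun p : ℝ≥0 × X => f p.1 p.2) ∧
    ∀ (t : ℝ≥0) (A : Set X), MeasurableSet A → μ (f t ⁻¹' A) = μ A}

section Raw

variable {X : Type u} [TopologicalSpace X] (φ : Flow ℝ≥0 X) (D : Set X) (I : D → X)

/-- `τ₁ x`: the infimum of the times `t > 0` with `φ_t x ∈ D`, and `∞` if there are none. -/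
def firstTime (x : X) : ℝ≥0∞ :=
  ⨅ (t : ℝ≥0) (_ : 0 < t ∧ φ t x ∈ D), (t : ℝ≥0∞)

open Classical in
/-- The state `I (φ_{τ₁ x} x)` right after the first impulse of `x`. If there is no
impulse, the value is irrelevant (and set to `x`). For compact `D` and `0 < τ₁ x < ∞` the
condition of the case distinction holds. -/
def impulse (x : X) : X :=
  if h : firstTime φ D x < ⊤ ∧ φ (firstTime φ D x).toNNReal x ∈ D then I ⟨_, h.2⟩ else x

/-- The state `γ_x(τ_n(x))` right after the `n`-th impulse; for `n = 0` it is `x`. -/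
def impulseState (x : X) : ℕ → X
  | 0 => x
  | n + 1 => impulse φ D I (impulseState x n)

/-- The `n`-th impulsive time `τ_n(x)`, with `τ_0(x) = 0`; it is `∞` as soon as
there are fewer than `n` impulses. -/
def impulseTime (x : X) : ℕ → ℝ≥0∞
  | 0 => 0
  | n + 1 => impulseTime x n + firstTime φ D (impulseState φ D I x n)

/-- The impulsive trajectory `γ_x`: for `τ_n(x) ≤ t < τ_{n+1}(x)` the value is
`φ_{t - τ_n(x)} (γ_x(τ_n(x)))`. The index `n` is the least one with `t < τ_{n+1}(x)`;
it exists for all `t` below `sup_n τ_n(x)`. -/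
def trajectory (x : X) (t : ℝ≥0) : X :=
  let n := sInf {n : ℕ | (t : ℝ≥0∞) < impulseTime φ D I x (n + 1)}
  φ (t - (impulseTime φ D I x n).toNNReal) (impulseState φ D I x n)

end Raw

/-- An impulsive dynamical system `(X, φ, D, I)`: a continuous semiflow, a compact set `D` and
a continuous map `I : D → X` such that `τ₁ x > 0` and `sup_n τ_n(x) = ∞` for all `x`. -/
structure System (X : Type u) [TopologicalSpace X] where
  flow : Flow ℝ≥0 X
  D : Set X
  I : D → X
  isCompact_D : IsCompact D
  continuous_I : Continuous I
  firstTime_pos : ∀ x : X, 0 < firstTime flow D x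
  length_eq_top : ∀ x : X, ⨆ n : ℕ, impulseTime flow D I x n = ⊤

namespace System

variable {X : Type u} [TopologicalSpace X] (S : System X)

/-- The impulsive semiflow. -/
def semiflow (t : ℝ≥0) (x : X) : X := trajectory S.flow S.D S.I x t

/-- The non-wandering set of the impulsive semiflow. -/
def Omega : Set X := nonWanderingSet S.semiflow

open Classical in
/-- The function `τ_D` on the non-wandering set: `0` on `D` and `τ₁` off `D`. -/
def tauD (x : S.Omega) : ℝ≥0∞ :=
  if (x : X) ∈ S.D then 0 else firstTime S.flow S.D (x : X)

/-- `x ∼ y` if `x = y`, `y = I x`, `x = I y` or `I x = I y` (wherever `I` is defined). -/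
def Rel (x y : X) : Prop :=
  x = y ∨ (∃ hx : x ∈ S.D, y = S.I ⟨x, hx⟩) ∨ (∃ hy : y ∈ S.D, x = S.I ⟨y, hy⟩) ∨
    ∃ (hx : x ∈ S.D) (hy : y ∈ S.D), S.I ⟨x, hx⟩ = S.I ⟨y, hy⟩

end System

end Impulsive

end

/-! Let `jump` be `I` on `D` and the identity off `D`. Since `I` maps `Ω ∩ D` into `Ω \ D`, `jump`
retracts `Ω` onto `Ω \ D`, and on `Ω` the relation `Rel` is the kernel of `jump` (`rel_iff`). So
each class has exactly one point off `D`, which makes `h` a bijection. The relation is closed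
because `D` is compact (`isClosed_rel`), so the quotient `Y` is compact Hausdorff, and metrizable as
an image of a compact metric space. The inverse of `h` is Borel by the Lusin–Souslin theorem.

The semiflow on `Y` is continuous because the quotient glues each impulse point to its image. Up to
and including the time `τ_D` the quotient orbit is `π` of the orbit of `φ`. From `τ_D` on it is the
quotient orbit of the point reached after the impulse, which depends continuously on the start
because `τ_D` is continuous. These two descriptions hold on closed sets that cover `ℝ≥0 × Ω`, and
induction on impulses gives continuity everywhere (`continuousAt_conj_of_after`,
`continuous_conj_quotient`).

An invariant probability measure lives on `Ω` by Poincaré recurrence. It does not charge `D`: a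
recurrent orbit that is in `D` at a small time `t` started in `D` and came back by time `t`, and the
set of such starting points shrinks to `∅` as `t → 0` (`measure_D_eq_zero`). So invariant measures
live on `Ω \ D`, where `h` transports them. -/

namespace Topology.IsQuotientMap

/-! ### Quotients of compact spaces by closed relations. -/

variable {Z Y : Type*} [TopologicalSpace Z] [TopologicalSpace Y] {π : Z → Y}

/-- A quotient of a compact space by a closed equivalence relation is a closed map. -/
theorem isClosedMap_of_isClosed_rel [CompactSpace Z] (hq : IsQuotientMap π)
    (hR : IsClosed {p : Z × Z | π p.1 = π p.2}) : IsClosedMap π := by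
  intro C hC
  rw [← hq.isClosed_preimage]
  have : π ⁻¹' (π '' C) = Prod.snd '' ({p : Z × Z | π p.1 = π p.2} ∩ Prod.fst ⁻¹' C) := by
    ext z
    constructor
    · rintro ⟨c, hc, h⟩
      exact ⟨(c, z), ⟨h, hc⟩, rfl⟩
    · rintro ⟨⟨c, z'⟩, ⟨h, hc⟩, rfl⟩
      exact ⟨c, hc, h⟩
  rw [this]
  exact isClosedMap_snd_of_compactSpace _ (hR.inter (hC.preimage continuous_fst))

/-- A quotient of a compact space by a closed equivalence relation is Hausdorff. -/
theorem t2Space_of_isClosed_rel [CompactSpace Z] (hq : IsQuotientMap π)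
    (hR : IsClosed {p : Z × Z | π p.1 = π p.2}) : T2Space Y := by
  -- Closed maps are not stable under products, but proper maps are; hence `π × π` is closed, and it
  -- carries the relation onto the diagonal.
  have hp : IsProperMap π := by
    rw [isProperMap_iff_isClosedMap_and_compact_fibers]
    refine ⟨hq.continuous, hq.isClosedMap_of_isClosed_rel hR, fun y => ?_⟩
    obtain ⟨z, rfl⟩ := hq.surjective y
    exact (hR.preimage (by fun_prop : Continuous fun w : Z => (w, z))).isCompact
  rw [t2_iff_isClosed_diagonal]
  have : diagonal Y = Prod.map π π '' {p : Z × Z | π p.1 = π p.2} := by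
    ext ⟨a, b⟩
    constructor
    · rintro (rfl : a = b)
      obtain ⟨z, rfl⟩ := hq.surjective a
      exact ⟨(z, z), rfl, rfl⟩
    · rintro ⟨⟨z, w⟩, h, h'⟩
      simp only [Prod.map_apply, Prod.mk.injEq] at h'
      rw [mem_diagonal_iff]
      exact h'.1.symm.trans (Eq.trans h h'.2)
  rw [this]
  exact (hp.prodMap hp).isClosedMap _ hR

end Topology.IsQuotientMap

/-- A Hausdorff continuous image of a compact metrizable space is metrizable. -/
theorem TopologicalSpace.MetrizableSpace.of_surjective_continuous {Z Y : Type*}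
    [TopologicalSpace Z] [CompactSpace Z] [T2Space Z] [SecondCountableTopology Z] [TopologicalSpace Y]
    [T2Space Y] {f : Z → Y} (hf : Continuous f) (hs : Function.Surjective f) :
    MetrizableSpace Y := by
  have : CompactSpace Y := hs.compactSpace hf
  -- Composition with `f` embeds `C(Y, ℝ)` isometrically into the separable space `C(Z, ℝ)`. A dense
  -- sequence in `C(Y, ℝ)` then separates points: a function within `1/2` of a Urysohn function for
  -- `a` and `b` takes different values there.
  let F : C(Y, ℝ) → C(Z, ℝ) := fun g => g.comp ⟨f, hf⟩
  have hF : Isometry F := Isometry.of_dist_eq fun g g' => by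
    rw [ContinuousMap.dist_eq_iSup, ContinuousMap.dist_eq_iSup]
    exact hs.iSup_comp (fun y => dist (g y) (g' y))
  have : SecondCountableTopology C(Y, ℝ) := hF.isEmbedding.isInducing.secondCountableTopology
  refine Metric.PiNatEmbed.TopologicalSpace.MetrizableSpace.of_countable_separating (fun n : ℕ => ⇑(denseSeq C(Y, ℝ) n))
    (fun n => (denseSeq C(Y, ℝ) n).continuous) fun a b hab => ?_
  obtain ⟨g, ha, hb, -⟩ := exists_continuous_zero_one_of_isClosed (isClosed_singleton (x := a))
    (isClosed_singleton (x := b)) (by simpa using hab)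
  obtain ⟨_, ⟨n, rfl⟩, hd⟩ := Metric.mem_closure_iff.1
    ((denseRange_denseSeq C(Y, ℝ)).closure_eq ▸ mem_univ g) (1 / 2) (by norm_num)
  refine ⟨n, fun h => ?_⟩
  have h1 := (ContinuousMap.dist_apply_le_dist a).trans_lt hd
  have h2 := (ContinuousMap.dist_apply_le_dist b).trans_lt hd
  have ha' : g a = 0 := ha rfl
  have hb' : g b = 1 := hb rfl
  rw [ha', h] at h1
  rw [hb'] at h2
  have := dist_triangle_right (0 : ℝ) 1 (denseSeq C(Y, ℝ) n b)
  rw [dist_zero_left, norm_one] at this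
  linarith

noncomputable section

namespace Impulsive

/-! ### First impulse times and restarting a trajectory. -/

section Raw

variable {X : Type u} [TopologicalSpace X] {φ : Flow ℝ≥0 X} {D : Set X} {I : D → X} {x : X}

theorem firstTime_le {t : ℝ≥0} (ht : 0 < t) (h : φ t x ∈ D) : firstTime φ D x ≤ t :=
  iInf₂_le t ⟨ht, h⟩

theorem flow_notMem_of_lt {t : ℝ≥0} (ht : 0 < t) (h : t < firstTime φ D x) : φ t x ∉ D :=
  fun hD => (firstTime_le ht hD).not_gt h

theorem firstTime_flow_add {t : ℝ≥0} (h : t < firstTime φ D x) :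
    firstTime φ D (φ t x) + t = firstTime φ D x := by
  apply le_antisymm
  · refine le_iInf₂ fun u hu => ?_
    have htu : t < u := by exact_mod_cast h.trans_le (firstTime_le hu.1 hu.2)
    obtain ⟨v, rfl⟩ := exists_add_of_le htu.le
    have hv : 0 < v := by simpa using htu
    have : firstTime φ D (φ t x) ≤ v := firstTime_le hv (by
      rw [← φ.map_add, add_comm]; exact hu.2)
    rw [add_comm t v]
    push_cast
    gcongr
  · rw [← tsub_le_iff_right]
    refine le_iInf₂ fun u hu => ?_
    rw [tsub_le_iff_right]
    refine (firstTime_le (t := u + t) (lt_of_lt_of_le hu.1 le_self_add) ?_).trans (by push_cast; rfl)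
    rw [φ.map_add]
    exact hu.2

/-- The first impulsive time is attained, if it is finite. -/
theorem flow_mem_of_firstTime_eq {τ : ℝ≥0} (hD : IsClosed D)
    (h : firstTime φ D x = τ) : φ τ x ∈ D := by
  have hcl : IsClosed {t : ℝ≥0 | φ t x ∈ D} :=
    hD.preimage (φ.continuous continuous_id continuous_const)
  refine hcl.closure_subset_iff.2 subset_rfl ?_
  rw [Metric.mem_closure_iff]
  intro ε hε
  lift ε to ℝ≥0 using hε.le
  have hε' : 0 < ε := by exact_mod_cast hε
  have hlt : firstTime φ D x < ((τ + ε : ℝ≥0) : ℝ≥0∞) := by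
    rw [h]; exact_mod_cast lt_add_of_pos_right τ hε'
  simp only [firstTime, iInf_lt_iff] at hlt
  obtain ⟨t, ht, hlt⟩ := hlt
  have h1 : t < τ + ε := by exact_mod_cast hlt
  have h2 : τ ≤ t := by exact_mod_cast h ▸ firstTime_le ht.1 ht.2
  refine ⟨t, ht.2, ?_⟩
  rw [NNReal.dist_eq, abs_sub_comm, abs_of_nonneg (sub_nonneg.2 (by exact_mod_cast h2))]
  have : (t : ℝ) < τ + ε := by exact_mod_cast h1
  linarith

theorem impulseState_succ (n : ℕ) :
    impulseState φ D I x (n + 1) = impulseState φ D I (impulse φ D I x) n := by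
  induction n with
  | zero => rfl
  | succ n ih => rw [impulseState, ih, impulseState]

theorem impulseTime_succ (n : ℕ) :
    impulseTime φ D I x (n + 1) =
      firstTime φ D x + impulseTime φ D I (impulse φ D I x) n := by
  induction n with
  | zero => simp [impulseTime, impulseState]
  | succ n ih => rw [impulseTime, ih, impulseState_succ, impulseTime, add_assoc]

theorem impulseTime_mono : Monotone (impulseTime φ D I x) :=
  monotone_nat_of_le_succ fun _ => le_self_add

theorem exists_lt_impulseTime (h : ⨆ n : ℕ, impulseTime φ D I x n = ⊤) (t : ℝ≥0) :
    ∃ n, t < impulseTime φ D I x n :=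
  lt_iSup_iff.1 (h ▸ ENNReal.coe_lt_top)

theorem exists_lt_impulseTime_succ (h : ⨆ n : ℕ, impulseTime φ D I x n = ⊤) (t : ℝ≥0) :
    {n : ℕ | t < impulseTime φ D I x (n + 1)}.Nonempty :=
  let ⟨n, hn⟩ := exists_lt_impulseTime h t
  ⟨n, hn.trans_le (impulseTime_mono n.le_succ)⟩

theorem trajectory_of_lt {t : ℝ≥0} (h : t < firstTime φ D x) :
    trajectory φ D I x t = φ t x := by
  have : sInf {n : ℕ | (t : ℝ≥0∞) < impulseTime φ D I x (n + 1)} = 0 :=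
    Nat.sInf_eq_zero.2 (Or.inl (by simpa [impulseTime, impulseState] using h))
  simp only [trajectory, this]
  simp [impulseTime, impulseState]

/-- Discarding the first impulse lowers every index by one and every impulse time by `τ`. -/
theorem trajectory_add {τ s : ℝ≥0} (hx : ⨆ n : ℕ, impulseTime φ D I x n = ⊤)
    (h : firstTime φ D x = τ) :
    trajectory φ D I x (τ + s) = trajectory φ D I (impulse φ D I x) s := by
  have hiff : ∀ n : ℕ, ((τ + s : ℝ≥0) : ℝ≥0∞) < impulseTime φ D I x (n + 1) ↔
      s < impulseTime φ D I (impulse φ D I x) n := fun n => by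
    rw [impulseTime_succ, h, ENNReal.coe_add]
    exact ENNReal.add_lt_add_iff_left ENNReal.coe_ne_top
  have hne := exists_lt_impulseTime_succ hx (τ + s)
  -- Index `0` would require `τ + s < τ`.
  have hpos : 1 ≤ sInf {n : ℕ | ((τ + s : ℝ≥0) : ℝ≥0∞) < impulseTime φ D I x (n + 1)} := by
    rw [Nat.one_le_iff_ne_zero]
    intro h0
    have := Nat.sInf_mem hne
    rw [h0, mem_ofPred_eq, hiff] at this
    simp [impulseTime] at this
  have hsInf := (Nat.sInf_add hpos).symm
  simp only [hiff] at hsInf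
  set m := sInf {n : ℕ | (s : ℝ≥0∞) < impulseTime φ D I (impulse φ D I x) (n + 1)} with hm
  -- By minimality of `m`, the `m`-th impulse time is at most `s`; finiteness lets `toNNReal`
  -- distribute over the sum below.
  have hfin : impulseTime φ D I (impulse φ D I x) m ≠ ⊤ := by
    refine ne_top_of_le_ne_top (b := (s : ℝ≥0∞)) ENNReal.coe_ne_top ?_
    rcases hm' : m with _ | k
    · simp [impulseTime]
    · by_contra! hlt
      have : m ≤ k := Nat.sInf_le hlt
      omega
  have e1 : sInf {n : ℕ | ((τ + s : ℝ≥0) : ℝ≥0∞) < impulseTime φ D I x (n + 1)} = m + 1 := by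
    simp only [hiff]
    exact hsInf
  simp only [trajectory, e1, ← hm]
  rw [impulseState_succ, impulseTime_succ, h, ENNReal.toNNReal_add ENNReal.coe_ne_top hfin,
    ENNReal.toNNReal_coe, add_tsub_add_eq_tsub_left]

end Raw

namespace System

/-! ### The semigroup law. -/

section Topological

variable {X : Type u} [TopologicalSpace X] (S : System X) {x : X}

open Classical in
/-- The impulse map `I`, extended by the identity off `D`. -/
def jump (x : X) : X :=
  if h : x ∈ S.D then S.I ⟨x, h⟩ else x

theorem jump_of_mem (h : x ∈ S.D) : S.jump x = S.I ⟨x, h⟩ := dif_pos h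

theorem jump_of_notMem (h : x ∉ S.D) : S.jump x = x := dif_neg h

theorem semiflow_of_lt {t : ℝ≥0} (h : t < firstTime S.flow S.D x) :
    S.semiflow t x = S.flow t x :=
  trajectory_of_lt h

theorem semiflow_zero (x : X) : S.semiflow 0 x = x :=
  (S.semiflow_of_lt (S.firstTime_pos x)).trans (S.flow.map_zero_apply x)

theorem pos_of_firstTime_eq {τ : ℝ≥0} (h : firstTime S.flow S.D x = τ) : 0 < τ := by
  simpa [h] using S.firstTime_pos x

theorem impulse_of_eq_top (h : firstTime S.flow S.D x = ⊤) :
    impulse S.flow S.D S.I x = x := by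
  simp [impulse, h]

variable [T2Space X]

theorem flow_mem_of_firstTime_eq {τ : ℝ≥0} (h : firstTime S.flow S.D x = τ) :
    S.flow τ x ∈ S.D :=
  Impulsive.flow_mem_of_firstTime_eq S.isCompact_D.isClosed h

theorem impulse_eq {τ : ℝ≥0} (h : firstTime S.flow S.D x = τ) :
    impulse S.flow S.D S.I x = S.jump (S.flow τ x) := by
  have hD := S.flow_mem_of_firstTime_eq h
  rw [S.jump_of_mem hD, impulse, dif_pos]
  · simp [h]
  · simpa [h] using hD

theorem semiflow_add_of_firstTime_eq {τ : ℝ≥0} (h : firstTime S.flow S.D x = τ) (s : ℝ≥0) :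
    S.semiflow (τ + s) x = S.semiflow s (S.jump (S.flow τ x)) := by
  rw [← S.impulse_eq h]
  exact trajectory_add (S.length_eq_top x) h

/-- Induction along the impulses of a trajectory. -/
theorem impulse_induction {p : ℝ≥0 → X → Prop}
    (before : ∀ (t : ℝ≥0) x, (t : ℝ≥0∞) < firstTime S.flow S.D x → p t x)
    (after : ∀ (τ s : ℝ≥0) x, firstTime S.flow S.D x = τ →
      p s (S.jump (S.flow τ x)) → p (τ + s) x) (t : ℝ≥0) (x : X) : p t x := by
  -- The induction runs over an `n` with `t < τ_n(x)`, which drops by one after each impulse.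
  obtain ⟨n, hn⟩ := exists_lt_impulseTime (S.length_eq_top x) t
  induction n generalizing t x with
  | zero => simp [impulseTime] at hn
  | succ n ih =>
    rcases lt_or_ge (t : ℝ≥0∞) (firstTime S.flow S.D x) with h | h
    · exact before t x h
    · lift firstTime S.flow S.D x to ℝ≥0 using ne_top_of_le_ne_top ENNReal.coe_ne_top h
        with τ hτ
      obtain ⟨s, rfl⟩ := exists_add_of_le (ENNReal.coe_le_coe.1 h)
      refine after τ s x hτ.symm (ih _ _ ?_)
      rw [impulseTime_succ, ← hτ, ENNReal.coe_add, S.impulse_eq hτ.symm] at hn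
      exact (ENNReal.add_lt_add_iff_left ENNReal.coe_ne_top).1 hn

/-- Induction on the impulses up to time `t`. The case with content has no impulse up to `t` but one
by `s + t`: then `x` and `φ_t x` have their first impulse at the same point of `D`. -/
theorem semiflow_add (s t : ℝ≥0) (x : X) :
    S.semiflow (s + t) x = S.semiflow s (S.semiflow t x) := by
  induction t, x using S.impulse_induction generalizing s with
  | before t x h =>
    have hadd := firstTime_flow_add h
    rw [S.semiflow_of_lt h]
    rcases lt_or_ge ((s + t : ℝ≥0) : ℝ≥0∞) (firstTime S.flow S.D x) with hs | hs
    · rw [S.semiflow_of_lt hs, S.flow.map_add, S.semiflow_of_lt]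
      rwa [← hadd, ENNReal.coe_add, ENNReal.add_lt_add_iff_right ENNReal.coe_ne_top] at hs
    · have hfin := ne_top_of_le_ne_top ENNReal.coe_ne_top hs
      have hfin' : firstTime S.flow S.D (S.flow t x) ≠ ⊤ := fun h' => by simp [← hadd, h'] at hfin
      lift firstTime S.flow S.D (S.flow t x) to ℝ≥0 using hfin' with σ hσ
      rw [← hadd, ← ENNReal.coe_add, ENNReal.coe_le_coe, add_le_add_iff_right] at hs
      obtain ⟨r, rfl⟩ := exists_add_of_le hs
      rw [add_right_comm, S.semiflow_add_of_firstTime_eq (by rw [← hadd, ENNReal.coe_add]),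
        S.semiflow_add_of_firstTime_eq hσ.symm, S.flow.map_add]
  | after τ r x h ih =>
    rw [add_left_comm, S.semiflow_add_of_firstTime_eq h, S.semiflow_add_of_firstTime_eq h, ih]

theorem iterate_semiflow_one (n : ℕ) (x : X) : (S.semiflow 1)^[n] x = S.semiflow n x := by
  induction n with
  | zero => simp [S.semiflow_zero]
  | succ n ih => rw [Function.iterate_succ_apply', ih, Nat.cast_succ, add_comm, S.semiflow_add]

end Topological

/-! ### Borel measurability of the impulsive semiflow. -/

section Measurable

variable {X : Type u} [MetricSpace X] [MeasurableSpace X] [BorelSpace X] (S : System X)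

open Classical in
theorem measurable_jump : Measurable S.jump :=
  Measurable.dite (f := S.I) (g := fun x => (x : X)) S.continuous_I.measurable
    measurable_subtype_coe S.isCompact_D.measurableSet

variable [CompactSpace X]

/-- Sublevel sets are σ-compact: as the infimum is attained and positive, they are unions of
projections of compact sets of pairs `(t, x)` with `t` bounded away from `0`. -/
theorem measurable_firstTime : Measurable (firstTime S.flow S.D) := by
  refine measurable_of_Iic fun s => ?_
  induction s with
  | top => simp
  | coe s =>
    have : firstTime S.flow S.D ⁻¹' Iic (s : ℝ≥0∞) =
        ⋃ n : ℕ, Prod.snd '' ((Icc ((n : ℝ≥0) + 1)⁻¹ s ×ˢ univ) ∩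
          {p : ℝ≥0 × X | S.flow p.1 p.2 ∈ S.D}) := by
      ext x
      simp only [mem_preimage, mem_Iic, mem_iUnion, mem_image, mem_inter_iff, mem_prod, mem_Icc,
        mem_univ, and_true, mem_ofPred_eq, Prod.exists, exists_eq_right]
      constructor
      · intro h
        lift firstTime S.flow S.D x to ℝ≥0 using ne_top_of_le_ne_top ENNReal.coe_ne_top h
          with τ hτ
        obtain ⟨n, hn⟩ := exists_nat_one_div_lt (S.pos_of_firstTime_eq hτ.symm)
        exact ⟨n, τ, ⟨by simpa using hn.le, ENNReal.coe_le_coe.1 h⟩,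
          S.flow_mem_of_firstTime_eq hτ.symm⟩
      · rintro ⟨n, t, ⟨h1, h2⟩, h3⟩
        have ht : 0 < t := lt_of_lt_of_le (by positivity) h1
        exact (firstTime_le ht h3).trans (ENNReal.coe_le_coe.2 h2)
    rw [this]
    refine MeasurableSet.iUnion fun n => IsCompact.measurableSet ?_
    exact ((isCompact_Icc.prod isCompact_univ).inter_right
      (S.isCompact_D.isClosed.preimage S.flow.cont')).image continuous_snd

theorem measurable_flow : Measurable fun p : ℝ≥0 × X => S.flow p.1 p.2 :=
  S.flow.cont'.measurable

theorem measurable_impulse : Measurable (impulse S.flow S.D S.I) := by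
  have : impulse S.flow S.D S.I = fun x => if firstTime S.flow S.D x = ⊤ then x else
      S.jump (S.flow (firstTime S.flow S.D x).toNNReal x) := by
    ext x
    split_ifs with h
    · exact S.impulse_of_eq_top h
    · exact S.impulse_eq (ENNReal.coe_toNNReal h).symm
  rw [this]
  exact Measurable.ite (S.measurable_firstTime (measurableSet_singleton ⊤)) measurable_id
    (S.measurable_jump.comp
      (S.measurable_flow.comp (S.measurable_firstTime.ennreal_toNNReal.prodMk measurable_id)))

theorem measurable_impulseState (n : ℕ) :
    Measurable fun x => impulseState S.flow S.D S.I x n := by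
  induction n with
  | zero => exact measurable_id
  | succ n ih => exact S.measurable_impulse.comp ih

theorem measurable_impulseTime (n : ℕ) :
    Measurable fun x => impulseTime S.flow S.D S.I x n := by
  induction n with
  | zero => exact measurable_const
  | succ n ih => exact ih.add (S.measurable_firstTime.comp (S.measurable_impulseState n))

theorem measurable_semiflow : Measurable fun p : ℝ≥0 × X => S.semiflow p.1 p.2 := by
  -- The number of impulses up to and including time `p.1`; for a fixed value of it the trajectory
  -- is a measurable expression.
  let N : ℝ≥0 × X → ℕ := fun p =>
    sInf {n : ℕ | (p.1 : ℝ≥0∞) < impulseTime S.flow S.D S.I p.2 (n + 1)}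
  have hN : Measurable N := by
    refine measurable_of_Iic fun n => ?_
    have : N ⁻¹' Iic n =
        {p | (p.1 : ℝ≥0∞) < impulseTime S.flow S.D S.I p.2 (n + 1)} := by
      ext p
      refine ⟨fun h => ?_, fun h => Nat.sInf_le h⟩
      have hmem := Nat.sInf_mem (exists_lt_impulseTime_succ (S.length_eq_top p.2) p.1)
      exact lt_of_lt_of_le hmem (impulseTime_mono (Nat.succ_le_succ h))
    rw [this]
    exact measurableSet_lt measurable_fst.coe_nnreal_ennreal
      ((S.measurable_impulseTime (n + 1)).comp measurable_snd)
  have hG : Measurable fun q : ℕ × (ℝ≥0 × X) =>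
      S.flow (q.2.1 - (impulseTime S.flow S.D S.I q.2.2 q.1).toNNReal)
        (impulseState S.flow S.D S.I q.2.2 q.1) :=
    measurable_from_prod_countable_right fun n => S.measurable_flow.comp
      ((measurable_fst.sub
        ((S.measurable_impulseTime n).comp measurable_snd).ennreal_toNNReal).prodMk
        ((S.measurable_impulseState n).comp measurable_snd))
  exact hG.comp (hN.prodMk measurable_id)

theorem measurable_semiflow_apply (t : ℝ≥0) : Measurable (S.semiflow t) :=
  S.measurable_semiflow.comp measurable_prodMk_left

end Measurable

end System

end Impulsive

namespace Impulsive

theorem isClosed_nonWanderingSet {X : Type u} [TopologicalSpace X] (f : ℝ≥0 → X → X) :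
    IsClosed (nonWanderingSet f) := by
  rw [← closure_subset_iff_isClosed]
  intro x hx U hU T hT
  obtain ⟨y, hyV, hy⟩ := mem_closure_iff_nhds.1 hx _ (interior_mem_nhds.2 hU)
  exact hy U (mem_interior_iff_mem_nhds.1 hyV) T hT

namespace System

/-! ### Invariance of the non-wandering set, and the relation on it. -/

section Omega

variable {X : Type u} [TopologicalSpace X] (S : System X) {x : X}

theorem isClosed_Omega : IsClosed S.Omega := isClosed_nonWanderingSet _

/-- A return of `y` to the preimage of `U` under the time-`t` map is carried by that map to a return
to `U`. -/
theorem mem_Omega_of_continuousAt (hx : x ∈ S.Omega) {t : ℝ≥0} (hf : ContinuousAt (S.semiflow t) x)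
    (hadd : ∀ s y, S.semiflow t (S.semiflow s y) = S.semiflow s (S.semiflow t y)) :
    S.semiflow t x ∈ S.Omega := by
  intro U hU T hT
  obtain ⟨s, hs, y, hy, hy'⟩ := hx _ (hf hU) T hT
  refine ⟨s, hs, S.semiflow t y, ?_, hy'⟩
  have : S.semiflow t (S.semiflow s y) ∈ U := hy
  rwa [hadd] at this

variable [T2Space X]

/-- The compact orbit segment over `[0, t]` misses the closed set `D`, and so do nearby segments.
The condition `x ∉ D` covers time `0`, which `firstTime` ignores. -/
theorem eventually_lt_firstTime (hx : x ∉ S.D) {t : ℝ≥0} (ht : t < firstTime S.flow S.D x) :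
    ∀ᶠ y in 𝓝 x, (t : ℝ≥0∞) < firstTime S.flow S.D y := by
  have hev : ∀ᶠ y in 𝓝 x, ∀ s ∈ Icc 0 t, S.flow s y ∉ S.D := by
    refine isCompact_Icc.eventually_forall_of_forall_eventually fun s hs => ?_
    have hmem : S.flow s x ∉ S.D := by
      rcases eq_or_lt_of_le hs.1 with rfl | hs0
      · rwa [S.flow.map_zero_apply]
      · exact flow_notMem_of_lt hs0 (lt_of_le_of_lt (ENNReal.coe_le_coe.2 hs.2) ht)
    have hc : Continuous fun z : X × ℝ≥0 => S.flow z.2 z.1 :=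
      S.flow.continuous continuous_snd continuous_fst
    exact (S.isCompact_D.isClosed.isOpen_compl.preimage hc).mem_nhds hmem
  filter_upwards [hev] with y hy
  by_contra! h
  lift firstTime S.flow S.D y to ℝ≥0 using ne_top_of_le_ne_top ENNReal.coe_ne_top h with τ hτ
  exact hy τ ⟨zero_le, ENNReal.coe_le_coe.1 h⟩ (S.flow_mem_of_firstTime_eq hτ.symm)

theorem continuousAt_semiflow (hx : x ∉ S.D) {t : ℝ≥0} (ht : t < firstTime S.flow S.D x) :
    ContinuousAt (S.semiflow t) x := by
  have hc : ContinuousAt (fun y => S.flow t y) x :=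
    (S.flow.continuous continuous_const continuous_id).continuousAt
  refine hc.congr ?_
  filter_upwards [S.eventually_lt_firstTime hx ht] with y hy using (S.semiflow_of_lt hy).symm

theorem flow_mem_Omega_of_lt (hx : x ∈ S.Omega \ S.D) {t : ℝ≥0}
    (ht : t < firstTime S.flow S.D x) : S.flow t x ∈ S.Omega := by
  rw [← S.semiflow_of_lt ht]
  refine S.mem_Omega_of_continuousAt hx.1 (S.continuousAt_semiflow hx.2 ht) fun s y => ?_
  rw [← S.semiflow_add, ← S.semiflow_add, add_comm]

/-- The impulse point is the limit of `φ_t x` as `t ↑ τ`, and `Ω` is closed. -/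
theorem flow_mem_Omega_of_eq (hx : x ∈ S.Omega \ S.D) {τ : ℝ≥0}
    (h : firstTime S.flow S.D x = τ) : S.flow τ x ∈ S.Omega := by
  have hc : Continuous fun t => S.flow t x := S.flow.continuous continuous_id continuous_const
  have hsub : Iio τ ⊆ (fun t => S.flow t x) ⁻¹' S.Omega := fun t ht =>
    S.flow_mem_Omega_of_lt hx (h ▸ ENNReal.coe_lt_coe.2 ht)
  have hcl := closure_minimal hsub (S.isClosed_Omega.preimage hc)
  rw [closure_Iio' (show (Iio τ).Nonempty from ⟨0, S.pos_of_firstTime_eq h⟩)] at hcl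
  exact hcl self_mem_Iic

variable (hI : ∀ x : S.D, (x : X) ∈ S.Omega → S.I x ∈ S.Omega \ S.D)

omit [T2Space X] in
include hI in
theorem jump_mem (hx : x ∈ S.Omega) : S.jump x ∈ S.Omega \ S.D := by
  by_cases h : x ∈ S.D
  · rw [S.jump_of_mem h]
    exact hI ⟨x, h⟩ hx
  · rw [S.jump_of_notMem h]
    exact ⟨hx, h⟩

include hI in
/-- `Ω \ D` is forward invariant under the impulsive semiflow. -/
theorem semiflow_mem (t : ℝ≥0) (hx : x ∈ S.Omega \ S.D) :
    S.semiflow t x ∈ S.Omega \ S.D := by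
  induction t, x using S.impulse_induction with
  | before t x h =>
    rcases eq_or_ne t 0 with rfl | ht
    · rwa [S.semiflow_zero]
    · rw [S.semiflow_of_lt h]
      exact ⟨S.flow_mem_Omega_of_lt hx h, flow_notMem_of_lt (pos_iff_ne_zero.2 ht) h⟩
  | after τ s x h ih =>
    rw [S.semiflow_add_of_firstTime_eq h]
    exact ih (S.jump_mem hI (S.flow_mem_Omega_of_eq hx h))

omit [T2Space X] in
include hI in
-- Points of `I(Ω ∩ D)` miss `D`, so `jump` fixes them; hence `x` and `I x` have the same jump. In
-- particular the relation is an equivalence on `Ω`.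
theorem rel_iff {x y : X} (hx : x ∈ S.Omega) (hy : y ∈ S.Omega) :
    S.Rel x y ↔ S.jump x = S.jump y := by
  by_cases hxD : x ∈ S.D <;> by_cases hyD : y ∈ S.D
  · rw [S.jump_of_mem hxD, S.jump_of_mem hyD]
    refine ⟨?_, fun h => Or.inr (Or.inr (Or.inr ⟨hxD, hyD, h⟩))⟩
    rintro (rfl | ⟨hx', rfl⟩ | ⟨hy', rfl⟩ | ⟨_, _, h⟩)
    · rfl
    · exact absurd hyD (hI ⟨x, hx'⟩ hx).2
    · exact absurd hxD (hI ⟨y, hy'⟩ hy).2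
    · exact h
  · rw [S.jump_of_mem hxD, S.jump_of_notMem hyD]
    refine ⟨?_, fun h => Or.inr (Or.inl ⟨hxD, h.symm⟩)⟩
    rintro (rfl | ⟨_, h⟩ | ⟨hy', _⟩ | ⟨_, hy', _⟩)
    · exact absurd hxD hyD
    · exact h.symm
    · exact absurd hy' hyD
    · exact absurd hy' hyD
  · rw [S.jump_of_notMem hxD, S.jump_of_mem hyD]
    refine ⟨?_, fun h => Or.inr (Or.inr (Or.inl ⟨hyD, h⟩))⟩
    rintro (rfl | ⟨hx', _⟩ | ⟨_, h⟩ | ⟨hx', _⟩)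
    · exact absurd hyD hxD
    · exact absurd hx' hxD
    · exact h
    · exact absurd hx' hxD
  · rw [S.jump_of_notMem hxD, S.jump_of_notMem hyD]
    refine ⟨?_, Or.inl⟩
    rintro (h | ⟨hx', _⟩ | ⟨hy', _⟩ | ⟨hx', _⟩)
    · exact h
    · exact absurd hx' hxD
    · exact absurd hy' hyD
    · exact absurd hx' hxD

/-- The diagonal, the graph of `I`, its transpose and the fibre product of `I` with itself are
closed, the last three as images of compact sets. -/
theorem isClosed_rel : IsClosed {p : X × X | S.Rel p.1 p.2} := by
  have : CompactSpace S.D := isCompact_iff_compactSpace.1 S.isCompact_D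
  have hI := S.continuous_I
  have h1 : IsClosed (range fun d : S.D => ((d : X), S.I d)) :=
    (isCompact_range (by fun_prop)).isClosed
  have h2 : IsClosed (range fun d : S.D => (S.I d, (d : X))) :=
    (isCompact_range (by fun_prop)).isClosed
  have h3 : IsClosed ((fun q : S.D × S.D => ((q.1 : X), (q.2 : X))) ''
      {q | S.I q.1 = S.I q.2}) :=
    ((isClosed_eq (by fun_prop) (by fun_prop)).isCompact.image (by fun_prop)).isClosed
  convert! isClosed_diagonal.union (h1.union (h2.union h3)) using 1
  ext ⟨x, y⟩
  simp only [Rel, mem_ofPred_eq, mem_union, mem_diagonal_iff, mem_range, mem_image, Prod.mk.injEq,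
    Prod.exists]
  refine or_congr Iff.rfl (or_congr ?_ (or_congr ?_ ?_))
  · exact ⟨fun ⟨h, e⟩ => ⟨⟨x, h⟩, rfl, e.symm⟩, fun ⟨d, h, e⟩ => by subst h; exact ⟨d.2, e.symm⟩⟩
  · exact ⟨fun ⟨h, e⟩ => ⟨⟨y, h⟩, e.symm, rfl⟩, fun ⟨d, e, h⟩ => by subst h; exact ⟨d.2, e.symm⟩⟩
  · exact ⟨fun ⟨h, h', e⟩ => ⟨⟨x, h⟩, ⟨y, h'⟩, e, rfl, rfl⟩, fun ⟨d, d', e, h, h'⟩ => by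
      subst h h'; exact ⟨d.2, d'.2, e⟩⟩

end Omega

/-! ### Continuity of the semiflow on the quotient. -/

section Conjugacy

variable {X Y : Type u} [TopologicalSpace X] [T2Space X] [TopologicalSpace Y] (S : System X)
  (hτ : Continuous S.tauD) (hI : ∀ x : S.D, (x : X) ∈ S.Omega → S.I x ∈ S.Omega \ S.D)
  {π : S.Omega → Y} (hπ : IsQuotientMap π)
  (h : (S.Omega \ S.D : Set X) ≃ Y)
  (hjump : ∀ x : S.Omega, π x = h ⟨S.jump x, S.jump_mem hI x.2⟩)

omit [T2Space X] in
theorem tauD_of_mem {x : S.Omega} (hx : (x : X) ∈ S.D) : S.tauD x = 0 := if_pos hx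

omit [T2Space X] in
theorem tauD_of_notMem {x : S.Omega} (hx : (x : X) ∉ S.D) :
    S.tauD x = firstTime S.flow S.D x := if_neg hx

theorem flow_mem_Omega_of_le_tauD {x : S.Omega} {t : ℝ≥0} (ht : t ≤ S.tauD x) :
    S.flow t x ∈ S.Omega := by
  by_cases hx : (x : X) ∈ S.D
  · have : t = 0 := by simpa [S.tauD_of_mem hx] using ht
    rw [this, S.flow.map_zero_apply]
    exact x.2
  · rw [S.tauD_of_notMem hx] at ht
    rcases lt_or_eq_of_le ht with ht | ht
    · exact S.flow_mem_Omega_of_lt ⟨x.2, hx⟩ ht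
    · exact S.flow_mem_Omega_of_eq ⟨x.2, hx⟩ ht.symm

theorem flow_mem_D_of_tauD_eq {x : S.Omega} {t : ℝ≥0} (ht : S.tauD x = t) :
    S.flow t x ∈ S.D := by
  by_cases hx : (x : X) ∈ S.D
  · have : t = 0 := by simpa [S.tauD_of_mem hx] using ht.symm
    rwa [this, S.flow.map_zero_apply]
  · exact S.flow_mem_of_firstTime_eq (S.tauD_of_notMem hx ▸ ht)

/-- A start in `D` counts as an impulse at time `0`, in accordance with `τ_D = 0` there, so one
formula serves all of `Ω`. -/
theorem semiflow_jump_add_of_tauD_eq {x : S.Omega} {τ : ℝ≥0} (hx : S.tauD x = τ) (s : ℝ≥0) :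
    S.semiflow (τ + s) (S.jump x) = S.semiflow s (S.jump (S.flow τ x)) := by
  by_cases hD : (x : X) ∈ S.D
  · have : τ = 0 := by simpa [S.tauD_of_mem hD] using hx.symm
    rw [this, zero_add, S.flow.map_zero_apply]
  · rw [S.jump_of_notMem hD, S.semiflow_add_of_firstTime_eq (S.tauD_of_notMem hD ▸ hx)]

/-- The endpoint `t = τ_D(x)` is included: there both sides are the state just after the impulse. -/
theorem jump_flow_of_le_tauD {x : S.Omega} {t : ℝ≥0} (ht : t ≤ S.tauD x) :
    S.semiflow t (S.jump x) = S.jump (S.flow t x) := by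
  rcases lt_or_eq_of_le ht with ht' | ht'
  · have hD : (x : X) ∉ S.D := fun hD => by simp [S.tauD_of_mem hD] at ht'
    rw [S.tauD_of_notMem hD] at ht'
    rw [S.jump_of_notMem hD, S.semiflow_of_lt ht', S.jump_of_notMem]
    rcases eq_or_ne t 0 with rfl | h0
    · rwa [S.flow.map_zero_apply]
    · exact flow_notMem_of_lt (pos_iff_ne_zero.2 h0) ht'
  · simpa [S.semiflow_zero] using S.semiflow_jump_add_of_tauD_eq ht'.symm 0

/-- The map that `h : Ω \ D ≃ Y` conjugates with the time-`t` map of the impulsive semiflow. -/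
def conj (t : ℝ≥0) (y : Y) : Y :=
  h ⟨S.semiflow t (h.symm y), S.semiflow_mem hI t (h.symm y).2⟩

omit [TopologicalSpace Y] in
include hjump in
theorem conj_apply (t : ℝ≥0) (x : S.Omega) :
    S.conj hI h t (π x) =
      h ⟨S.semiflow t (S.jump x), S.semiflow_mem hI t (S.jump_mem hI x.2)⟩ := by
  simp [conj, hjump]

include hπ hjump in
-- On this region the map is `π (φ_t x)`, since `π` does not distinguish a point from its jump.
theorem continuousOn_conj_before :
    ContinuousOn (fun p : ℝ≥0 × S.Omega => S.conj hI h p.1 (π p.2))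
      {p | (p.1 : ℝ≥0∞) ≤ S.tauD p.2} := by
  rw [continuousOn_iff_continuous_domRestrict]
  have hc : Continuous fun p : {p : ℝ≥0 × S.Omega | (p.1 : ℝ≥0∞) ≤ S.tauD p.2} =>
      π ⟨S.flow p.1.1 p.1.2, S.flow_mem_Omega_of_le_tauD p.2⟩ :=
    hπ.continuous.comp ((S.flow.continuous (by fun_prop) (by fun_prop)).subtype_mk _)
  refine hc.congr fun p => ?_
  rw [domRestrict_apply, S.conj_apply hI h hjump, hjump]
  congr 2
  exact (S.jump_flow_of_le_tauD p.2).symm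

include hτ hjump in
-- One induction step: continuity at `p` follows from continuity at the pair of remaining time and
-- state after the impulse, if the impulse occurs by time `p.1`.
theorem continuousAt_conj_of_after {p : ℝ≥0 × S.Omega}
    (hbefore : ContinuousWithinAt (fun p : ℝ≥0 × S.Omega => S.conj hI h p.1 (π p.2))
      {p | (p.1 : ℝ≥0∞) ≤ S.tauD p.2} p)
    (hafter : ∀ (τ s : ℝ≥0), S.tauD p.2 = τ → p.1 = τ + s →
      ∀ z : S.Omega, (z : X) = S.jump (S.flow τ p.2) →
        ContinuousAt (fun p : ℝ≥0 × S.Omega => S.conj hI h p.1 (π p.2)) (s, z)) :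
    ContinuousAt (fun p : ℝ≥0 × S.Omega => S.conj hI h p.1 (π p.2)) p := by
  set E : Set (ℝ≥0 × S.Omega) := {p | S.tauD p.2 ≤ (p.1 : ℝ≥0∞)} with hE
  have hEcl : IsClosed E := isClosed_le (hτ.comp continuous_snd) (by fun_prop)
  have hfin : ∀ q : E, S.tauD q.1.2 ≠ ⊤ := fun q => ne_top_of_le_ne_top ENNReal.coe_ne_top q.2
  have hσ : ∀ q : E, S.tauD q.1.2 = ((S.tauD q.1.2).toNNReal : ℝ≥0) := fun q =>
    (ENNReal.coe_toNNReal (hfin q)).symm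
  have hσc : Continuous fun q : E => (S.tauD q.1.2).toNNReal :=
    ENNReal.continuousOn_toNNReal.comp_continuous (by fun_prop) hfin
  have hmemD : ∀ q : E, S.flow (S.tauD q.1.2).toNNReal q.1.2 ∈ S.D := fun q =>
    S.flow_mem_D_of_tauD_eq (hσ q)
  have hmemO : ∀ q : E, S.flow (S.tauD q.1.2).toNNReal q.1.2 ∈ S.Omega := fun q =>
    S.flow_mem_Omega_of_le_tauD (hσ q).ge
  -- `F` moves to the state just after the impulse at time `τ_D`; its continuity rests on that of
  -- `τ_D`, and `hshift` says that it preserves the value of the map.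
  let F : E → ℝ≥0 × S.Omega := fun q => (q.1.1 - (S.tauD q.1.2).toNNReal,
    ⟨S.I ⟨_, hmemD q⟩, (hI ⟨_, hmemD q⟩ (hmemO q)).1⟩)
  have hF : Continuous F := by
    refine Continuous.prodMk (by fun_prop) (Continuous.subtype_mk (S.continuous_I.comp
      (Continuous.subtype_mk (S.flow.continuous hσc (by fun_prop)) _)) _)
  have hFval : ∀ q : E, ((F q).2 : X) = S.jump (S.flow (S.tauD q.1.2).toNNReal q.1.2) := fun q =>
    (S.jump_of_mem (hmemD q)).symm
  have hle : ∀ q : E, (S.tauD q.1.2).toNNReal ≤ q.1.1 := fun q =>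
    ENNReal.coe_le_coe.1 ((hσ q).ge.trans q.2)
  have hshift : ∀ q : E, S.conj hI h q.1.1 (π q.1.2) = S.conj hI h (F q).1 (π (F q).2) := by
    intro q
    rw [S.conj_apply hI h hjump, S.conj_apply hI h hjump]
    congr 2
    have hnD : ((F q).2 : X) ∉ S.D := (hI ⟨_, hmemD q⟩ (hmemO q)).2
    rw [S.jump_of_notMem hnD, hFval, ← S.semiflow_jump_add_of_tauD_eq (hσ q),
      add_tsub_cancel_of_le (hle q)]
  have hwithin : ContinuousWithinAt (fun p : ℝ≥0 × S.Omega => S.conj hI h p.1 (π p.2)) E p := by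
    by_cases hp : p ∈ E
    · rw [continuousWithinAt_iff_continuousAt_domRestrict _ hp]
      have hca := hafter _ (F ⟨p, hp⟩).1 (hσ ⟨p, hp⟩) (add_tsub_cancel_of_le (hle ⟨p, hp⟩)).symm
        (F ⟨p, hp⟩).2 (hFval ⟨p, hp⟩)
      have hcomp := ContinuousAt.comp (f := F) (x := ⟨p, hp⟩) hca hF.continuousAt
      exact hcomp.congr (Eventually.of_forall fun q => (hshift q).symm)
    · exact continuousWithinAt_of_notMem_closure (by rwa [hEcl.closure_eq])
  have hunion := hbefore.union hwithin
  have huniv : {p : ℝ≥0 × S.Omega | (p.1 : ℝ≥0∞) ≤ S.tauD p.2} ∪ E = univ :=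
    eq_univ_of_forall fun q => le_total (q.1 : ℝ≥0∞) (S.tauD q.2)
  rwa [huniv, continuousWithinAt_univ] at hunion

include hτ hπ hjump in
theorem continuous_conj_quotient :
    Continuous fun p : ℝ≥0 × S.Omega => S.conj hI h p.1 (π p.2) := by
  have hbefore : ∀ p, ContinuousWithinAt (fun p : ℝ≥0 × S.Omega => S.conj hI h p.1 (π p.2))
      {p | (p.1 : ℝ≥0∞) ≤ S.tauD p.2} p := fun p => by
    by_cases hp : p ∈ {p : ℝ≥0 × S.Omega | (p.1 : ℝ≥0∞) ≤ S.tauD p.2}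
    · exact S.continuousOn_conj_before hI hπ h hjump p hp
    · have hcl : IsClosed {p : ℝ≥0 × S.Omega | (p.1 : ℝ≥0∞) ≤ S.tauD p.2} :=
        isClosed_le (by fun_prop) (hτ.comp continuous_snd)
      exact continuousWithinAt_of_notMem_closure (by rwa [hcl.closure_eq])
  -- Starting points off `D` come first, since there `τ_D` is the `τ₁` that governs the induction. A
  -- point of `D` lands off `D` after its impulse at time `0`, so it follows in one more step.
  have hoff : ∀ (t : ℝ≥0) (x : X) (hx : x ∈ S.Omega), x ∉ S.D →
      ContinuousAt (fun p : ℝ≥0 × S.Omega => S.conj hI h p.1 (π p.2)) (t, ⟨x, hx⟩) := by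
    intro t x
    induction t, x using S.impulse_induction with
    | before t x hlt =>
      intro hx hD
      refine S.continuousAt_conj_of_after hτ hI h hjump (hbefore _) fun τ s hσ hts => ?_
      rw [S.tauD_of_notMem hD] at hσ
      rw [hσ, ENNReal.coe_lt_coe] at hlt
      have hts' : t = τ + s := hts
      exact absurd (le_self_add.trans_eq hts'.symm) hlt.not_ge
    | after τ s x hfirst ih =>
      intro hx hD
      refine S.continuousAt_conj_of_after hτ hI h hjump (hbefore _) fun σ r hσ hts z hz => ?_
      rw [S.tauD_of_notMem hD, hfirst, ENNReal.coe_inj] at hσ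
      subst hσ
      obtain rfl : s = r := add_left_cancel hts
      have hz' := S.jump_mem hI (S.flow_mem_Omega_of_eq ⟨hx, hD⟩ hfirst)
      have := ih hz'.1 hz'.2
      convert this
  refine continuous_iff_continuousAt.2 fun p => ?_
  refine S.continuousAt_conj_of_after hτ hI h hjump (hbefore _) fun σ r hσ _ z hz => ?_
  have hz' : (z : X) ∈ S.Omega \ S.D :=
    hz ▸ S.jump_mem hI (S.flow_mem_Omega_of_le_tauD hσ.ge)
  exact hoff r z z.2 hz'.2

/-- The continuous semiflow on the quotient that `h` conjugates with the impulsive semiflow. -/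
def conjFlow : Flow ℝ≥0 Y where
  toFun := S.conj hI h
  -- As `ℝ≥0` is locally compact, `id × π` is again a quotient map.
  cont' := hπ.continuous_lift_prod_right (g := fun p => S.conj hI h p.1 p.2)
    (S.continuous_conj_quotient hτ hI hπ h hjump)
  map_add' s t y := by simp [conj, S.semiflow_add]
  map_zero' y := by simp [conj, S.semiflow_zero]

end Conjugacy

end System

end Impulsive

end

namespace Impulsive.System

/-! ### Invariant measures are carried by `Ω \ D`. -/

section Measure

variable {X : Type u} [MetricSpace X] [MeasurableSpace X] [BorelSpace X] (S : System X)

theorem measurableSet_Omega_diff_D : MeasurableSet (S.Omega \ S.D) :=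
  S.isClosed_Omega.measurableSet.diff S.isCompact_D.measurableSet

variable [CompactSpace X]
  (hI : ∀ x : S.D, (x : X) ∈ S.Omega → S.I x ∈ S.Omega \ S.D)
  {μ : Measure X} (hμ : μ ∈ invariantMeasures S.semiflow)

include hμ in
-- Poincaré recurrence for the time-one map: almost every point returns to each of its
-- neighbourhoods at arbitrarily large integer times.
theorem ae_mem_Omega : ∀ᵐ x ∂μ, x ∈ S.Omega := by
  have := hμ.1
  have hpres : MeasurePreserving (S.semiflow 1) μ μ := by
    refine ⟨S.measurable_semiflow_apply 1, Measure.ext fun A hA => ?_⟩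
    rw [Measure.map_apply (S.measurable_semiflow_apply 1) hA, hμ.2.2 1 A hA]
  filter_upwards [hpres.conservative.ae_frequently_mem_of_mem_nhds] with x hx U hU T _
  obtain ⟨n₀, hn₀⟩ := exists_nat_ge T
  obtain ⟨n, hn, hnU⟩ := frequently_atTop.1 (hx U hU) n₀
  rw [S.iterate_semiflow_one] at hnU
  exact ⟨n, hn₀.trans (Nat.cast_le.2 hn), x, hnU, mem_of_mem_nhds hU⟩

include hI hμ in
theorem measure_D_eq_zero : μ S.D = 0 := by
  have := hμ.1
  -- The points of `D` that `φ` brings back to `D` within time `1/(n+1)`. They decrease to `∅` since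
  -- `τ₁ > 0`.
  let B : ℕ → Set X := fun n =>
    S.D ∩ firstTime S.flow S.D ⁻¹' Iic (((n : ℝ≥0) + 1)⁻¹ : ℝ≥0)
  have hBmeas : ∀ n, MeasurableSet (B n) := fun n =>
    S.isCompact_D.measurableSet.inter (S.measurable_firstTime measurableSet_Iic)
  have hBanti : Antitone B := fun m n hmn => by
    refine inter_subset_inter_right _ (preimage_mono (Iic_subset_Iic.2 ?_))
    rw [ENNReal.coe_le_coe]
    gcongr
  have hBempty : ⋂ n, B n = ∅ := by
    refine eq_empty_of_forall_notMem fun x hx => ?_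
    rw [mem_iInter] at hx
    have hfin := ne_top_of_le_ne_top ENNReal.coe_ne_top (hx 0).2
    lift firstTime S.flow S.D x to ℝ≥0 using hfin with τ hτ
    obtain ⟨n, hn⟩ := exists_nat_one_div_lt (S.pos_of_firstTime_eq hτ.symm)
    have hle : firstTime S.flow S.D x ≤ (((n : ℝ≥0) + 1)⁻¹ : ℝ≥0) := (hx n).2
    rw [← hτ, ENNReal.coe_le_coe] at hle
    exact absurd hle (by simpa only [one_div, not_le] using hn)
  -- By invariance, `μ D` is the measure of the points that are in `D` at time `1/(n+1)`. Forward
  -- invariance of `Ω \ D` puts almost all of them in `D` at time `0`, and without an impulse by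
  -- then they could not be in `D` again.
  have hle : ∀ n, μ S.D ≤ μ (B n) := fun n => by
    rw [← hμ.2.2 ((n : ℝ≥0) + 1)⁻¹ S.D S.isCompact_D.measurableSet]
    refine measure_mono_ae ?_
    filter_upwards [S.ae_mem_Omega hμ] with x hxO hx
    have hxD : x ∈ S.D := by
      by_contra hxD
      exact (S.semiflow_mem hI _ ⟨hxO, hxD⟩).2 hx
    refine ⟨hxD, ?_⟩
    by_contra hlt
    have hlt : ((((n : ℝ≥0) + 1)⁻¹ : ℝ≥0) : ℝ≥0∞) < firstTime S.flow S.D x := not_le.1 hlt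
    refine flow_notMem_of_lt (by positivity) hlt ?_
    rw [← S.semiflow_of_lt hlt]
    exact hx
  have hlim := tendsto_measure_iInter_atTop (μ := μ) (fun n => (hBmeas n).nullMeasurableSet)
    hBanti ⟨0, measure_ne_top _ _⟩
  rw [hBempty, measure_empty] at hlim
  exact le_antisymm (ge_of_tendsto' hlim hle) zero_le

include hI hμ in
theorem ae_mem_Omega_diff_D : ∀ᵐ x ∂μ, x ∈ S.Omega \ S.D := by
  filter_upwards [S.ae_mem_Omega hμ, measure_eq_zero_iff_ae_notMem.1 (S.measure_D_eq_zero hI hμ)]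
    with x h1 h2 using ⟨h1, h2⟩

variable {Y : Type u} [TopologicalSpace Y] [SecondCountableTopology Y] [MeasurableSpace Y]
  [BorelSpace Y] {ψ : Flow ℝ≥0 Y} (h : (S.Omega \ S.D : Set X) ≃ᵐ Y)
  (hψ : ∀ (t : ℝ≥0) (x : (S.Omega \ S.D : Set X)),
    ∃ hx : S.semiflow t x ∈ S.Omega \ S.D, ψ t (h x) = h ⟨S.semiflow t x, hx⟩)

include hI hψ in
/-- A measurable conjugacy with `Ω \ D` carries the invariant measures to each other. -/
theorem bijOn_invariantMeasures :
    BijOn (fun ν : Measure Y => ν.map (fun y => ((h.symm y : (S.Omega \ S.D : Set X)) : X)))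
      (invariantMeasures (fun t y => ψ t y)) (invariantMeasures S.semiflow) := by
  have hk : MeasurableEmbedding fun y => ((h.symm y : (S.Omega \ S.D : Set X)) : X) :=
    (MeasurableEmbedding.subtype_coe S.measurableSet_Omega_diff_D).comp h.symm.measurableEmbedding
  set k : Y → X := fun y => ((h.symm y : (S.Omega \ S.D : Set X)) : X) with hk_def
  have hrange : range k = S.Omega \ S.D := by
    rw [hk_def, show (fun y => ((h.symm y : (S.Omega \ S.D : Set X)) : X)) =
      Subtype.val ∘ h.symm from rfl, h.symm.surjective.range_comp, Subtype.range_coe]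
  have hconj : ∀ t y, k (ψ t y) = S.semiflow t (k y) := fun t y => by
    obtain ⟨hx, e⟩ := hψ t (h.symm y)
    rw [h.apply_symm_apply] at e
    simp only [hk_def, e, h.symm_apply_apply]
  refine ⟨fun ν hν => ?_, fun ν _ ν' _ heq => ?_, fun μ hμ => ?_⟩
  · have := hν.1
    refine ⟨Measure.isProbabilityMeasure_map hk.measurable.aemeasurable, S.measurable_semiflow,
      fun t A hA => ?_⟩
    rw [Measure.map_apply hk.measurable (S.measurable_semiflow_apply t hA),
      Measure.map_apply hk.measurable hA, ← hν.2.2 t _ (hk.measurable hA)]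
    congr 1
    ext y
    simp [hconj]
  · rw [← hk.comap_map ν, ← hk.comap_map ν']
    exact congrArg (Measure.comap k) heq
  · have := hμ.1
    -- In general this only recovers the restriction of `μ` to the range `Ω \ D` of `k`, which has
    -- full measure.
    have hmap : (μ.comap k).map k = μ := by
      rw [hk.map_comap, hrange]
      exact Measure.restrict_eq_self_of_ae_mem (S.ae_mem_Omega_diff_D hI hμ)
    refine ⟨μ.comap k, ⟨?_, ψ.cont'.measurable, fun t A hA => ?_⟩, hmap⟩
    · refine ⟨?_⟩
      rw [← measure_univ (μ := μ), ← hmap, Measure.map_apply hk.measurable .univ, preimage_univ,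
        hmap]
    · rw [hk.comap_apply, hk.comap_apply, ← hμ.2.2 t _ (hk.measurableSet_image.2 hA)]
      refine measure_congr ?_
      filter_upwards [S.ae_mem_Omega_diff_D hI hμ] with x hx
      obtain ⟨y, rfl⟩ : x ∈ range k := hrange ▸ hx
      refine propext ?_
      change k y ∈ k '' ((ψ t) ⁻¹' A) ↔ S.semiflow t (k y) ∈ k '' A
      rw [← hconj, hk.injective.mem_set_image, hk.injective.mem_set_image, mem_preimage]

end Measure

end Impulsive.System

/-! ### Assembly of the quotient and the conjugacy. -/

theorem theoremC {X : Type u} [MetricSpace X] [CompactSpace X] [MeasurableSpace X] [BorelSpace X]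
    (S : Impulsive.System X)
    (hτ : Continuous S.tauD)
    (hI : ∀ x : S.D, (x : X) ∈ S.Omega → S.I x ∈ S.Omega \ S.D) :
    ∃ (Y : Type u) (_ : MetricSpace Y) (_ : CompactSpace Y) (_ : MeasurableSpace Y)
      (_ : BorelSpace Y) (π : S.Omega → Y) (ψ : Flow ℝ≥0 Y)
      (h : (S.Omega \ S.D : Set X) ≃ᵐ Y),
      -- `Y` is the quotient of the non-wandering set by the relation that `I` generates
      (IsQuotientMap π ∧ ∀ x y : S.Omega, π x = π y ↔ S.Rel x y) ∧
      -- `h` is continuous (and bimeasurable), and is the restriction of the projection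
      Continuous h ∧
      (∀ x : (S.Omega \ S.D : Set X), h x = π ⟨x, x.2.1⟩) ∧
      -- `Ω \ D` is forward invariant and `h` conjugates the two semiflows
      (∀ (t : ℝ≥0) (x : (S.Omega \ S.D : Set X)),
        ∃ hx : S.semiflow t x ∈ S.Omega \ S.D, ψ t (h x) = h ⟨S.semiflow t x, hx⟩) ∧
      -- the push-forward by `ι ∘ h⁻¹` is a bijection between the invariant measures
      BijOn (fun ν : Measure Y => ν.map (fun y => ((h.symm y : (S.Omega \ S.D : Set X)) : X)))
        (Impulsive.invariantMeasures (fun t y => ψ t y))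
        (Impulsive.invariantMeasures S.semiflow) := by
  have : CompactSpace S.Omega := isCompact_iff_compactSpace.1 S.isClosed_Omega.isCompact
  -- As a kernel this is an equivalence relation without further proof; `hrel` identifies it with
  -- `Rel`.
  let s : Setoid S.Omega := Setoid.ker fun x : S.Omega => S.jump x
  let π : S.Omega → Quotient s := Quotient.mk s
  have hπ : IsQuotientMap π := isQuotientMap_quotient_mk'
  have hπeq : ∀ x y : S.Omega, π x = π y ↔ S.jump x = S.jump y := fun x y => Quotient.eq
  have hrel : ∀ x y : S.Omega, π x = π y ↔ S.Rel x y := fun x y =>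
    (hπeq x y).trans (S.rel_iff hI x.2 y.2).symm
  have hR : IsClosed {p : S.Omega × S.Omega | π p.1 = π p.2} := by
    simp only [hrel]
    exact S.isClosed_rel.preimage
      (f := fun p : S.Omega × S.Omega => ((p.1 : X), (p.2 : X))) (by fun_prop)
  have : T2Space (Quotient s) := hπ.t2Space_of_isClosed_rel hR
  have : TopologicalSpace.MetrizableSpace (Quotient s) :=
    .of_surjective_continuous hπ.continuous hπ.surjective
  let : MetricSpace (Quotient s) := TopologicalSpace.metrizableSpaceMetric _
  let : MeasurableSpace (Quotient s) := borel _
  have : BorelSpace (Quotient s) := ⟨rfl⟩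
  let f : (S.Omega \ S.D : Set X) → Quotient s := fun x => π ⟨x, x.2.1⟩
  have hf : Continuous f := hπ.continuous.comp (by fun_prop)
  have hfinj : Function.Injective f := fun x y hxy => by
    have := (hπeq _ _).1 hxy
    rw [S.jump_of_notMem x.2.2, S.jump_of_notMem y.2.2] at this
    exact Subtype.ext this
  have hjump : ∀ x : S.Omega, π x = f ⟨S.jump x, S.jump_mem hI x.2⟩ := fun x =>
    (hπeq _ _).2 (S.jump_of_notMem (S.jump_mem hI x.2).2).symm
  have hfsurj : Function.Surjective f := fun y => by
    obtain ⟨x, rfl⟩ := hπ.surjective y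
    exact ⟨_, (hjump x).symm⟩
  have : StandardBorelSpace (S.Omega \ S.D : Set X) := S.measurableSet_Omega_diff_D.standardBorel
  -- Lusin–Souslin: an injective Borel map on a standard Borel space maps Borel sets to Borel sets.
  have hfemb : MeasurableEmbedding f := hf.measurable.measurableEmbedding hfinj
  let e := Equiv.ofBijective f ⟨hfinj, hfsurj⟩
  let h : (S.Omega \ S.D : Set X) ≃ᵐ Quotient s :=
    { e with
      measurable_toFun := hf.measurable
      measurable_invFun := fun A hA => by
        have := hfemb.measurableSet_image.2 hA
        rwa [show f '' A = e.symm ⁻¹' A from e.image_eq_preimage_symm A] at this }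
  let ψ : Flow ℝ≥0 (Quotient s) := S.conjFlow hτ hI hπ e hjump
  have hψ : ∀ (t : ℝ≥0) (x : (S.Omega \ S.D : Set X)),
      ∃ hx : S.semiflow t x ∈ S.Omega \ S.D, ψ t (h x) = h ⟨S.semiflow t x, hx⟩ := fun t x => by
    refine ⟨S.semiflow_mem hI t x.2, ?_⟩
    change e ⟨S.semiflow t (e.symm (e x)), _⟩ = e ⟨S.semiflow t x, _⟩
    simp only [e.symm_apply_apply]
  exact ⟨Quotient s, inferInstance, inferInstance, inferInstance, inferInstance, π, ψ, h,
    ⟨hπ, hrel⟩, hf, fun _ => rfl, hψ, S.bijOn_invariantMeasures hI h hψ⟩
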